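/- Let $x=(x_1,\dots,x_n)$ be freely noncommuting variables and let $\mathbb{C}\langle x\rangle$ be the free algebra, with the conjugate-linear involution $*$ that reverses words and fixes every $x_j$. Let $\mathscr{S}=\mathbb{C}[\varsigma(w) : w\neq 1 \text{ a word in } x]$ be the commutative polynomial algebra of state polynomials, with the conjugate-linear involution $\varsigma(w)^*=\varsigma(w^*)$, and let $\mathscr{S}\langle x\rangle=\mathscr{S}\otimes_{\mathbb{C}}\mathbb{C}\langle x\rangle$ be the $*$-algebra of noncommutative state polynomials, with the $\mathscr{S}$-linear unital map $\varsigma:\mathscr{S}\langle x\rangle\to\mathscr{S}$, $w\mapsto\varsigma(w)$. For a set $C$ of self-adjoint elements of $\mathscr{S}\langle x\rangle$ let $$\mathrm{QM}(C)=\Big\{\sum_j \varsigma(f_j^*c_jf_j)\ \text{(finite sums)} : f_j\in\mathscr{S}\langle x\rangle,\ c_j\in\{1\}\cup C\Big\}\subseteq\mathscr{S},$$ and call $C$ archimedean if there is $N>0$ with $N-x_1^2-\cdots-x_n^2=\sum_j f_j^*c_jf_j$ (a finite sum) for some $f_j\in\mathscr{S}\langle x\rangle$, $c_j\in\{1\}\cup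 C$. Let $\mathcal{H}$ be a separable infinite-dimensional complex Hilbert space, and let $\mathcal{D}^\infty(C)$ be the set of pairs $(\lambda,X)$, where $\lambda$ is a state (positive unital linear functional) on $\mathcal{B}(\mathcal{H})$ and $X=(X_1,\dots,X_n)$ is a tuple of self-adjoint bounded operators on $\mathcal{H}$, such that $c(\lambda,X)\succeq 0$ for all $c\in C$; here $g(\lambda,X)\in\mathcal{B}(\mathcal{H})$ is obtained from $g\in\mathscr{S}\langle x\rangle$ by replacing $x_j$ with $X_j$ and $\varsigma$ with $\lambda$. Let $C\subseteq\mathscr{S}\langle x\rangle$ be an archimedean set of self-adjoint elements, let $f=f^*\in\mathscr{S}\langle x\rangle$, and let $x_0$ be an additional self-adjoint variable, freely independent of $x_1,\dots,x_n$. Then the following are equivalent: (i) $f(\lambda,X)\succeq 0$ for all $(\lambda,X)\in\mathcal{D}^\infty(C)$; (ii) $\varsigma(x_0fx_0)+\varepsilon\in\mathrm{QM}\big(C\cup\{1-x_0^2,\,-(1-x_0^2)\}\big)$ for every real $\varepsilon>0$, where this is the state quadratic module within the state polynomials in the variables $x_0,x_1,\dots,x_n$. -/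

import Mathlib

open scoped TensorProduct ComplexOrder

noncomputable section

namespace StatePolynomials

/-! ### The algebras of noncommutative, state, and noncommutative state polynomials

The variables are indexed by a type `σ`; words are elements of `FreeMonoid σ`, on which Mathlib's
`star` is the reversal of words. -/

/-- Noncommutative polynomials `ℂ⟨x⟩`: the complex monoid algebra of the free monoid of words. -/
abbrev NCPoly (σ : Type) : Type := MonoidAlgebra ℂ (FreeMonoid σ)

/-- State polynomials: the commutative polynomial algebra `ℂ[ς(w) : w ≠ 1]`. -/
abbrev StatePoly (σ : Type) : Type := MvPolynomial {w : FreeMonoid σ // w ≠ 1} ℂ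

section Involutions

variable {σ : Type}

/-- The conjugate-linear involution on `ℂ⟨x⟩` fixing the variables:
`∑ a_w w ↦ ∑ conj(a_w) w*`. -/
instance instStarNCPoly : Star (NCPoly σ) where
  star p := MonoidAlgebra.mapDomain star (MonoidAlgebra.mapRingHom (FreeMonoid σ) (starRingEnd ℂ) p)

theorem NCPoly.star_single (w : FreeMonoid σ) (a : ℂ) :
    star (MonoidAlgebra.single w a : NCPoly σ) = MonoidAlgebra.single (star w) (star a) := by
  change MonoidAlgebra.mapDomain _ (MonoidAlgebra.mapRingHom _ _ (MonoidAlgebra.single w a)) = _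
  rw [MonoidAlgebra.mapRingHom_single, MonoidAlgebra.mapDomain_single, starRingEnd_apply]

theorem NCPoly.star_add' (p q : NCPoly σ) : star (p + q) = star p + star q := by
  change MonoidAlgebra.mapDomain _ _ = MonoidAlgebra.mapDomain _ _ + MonoidAlgebra.mapDomain _ _
  rw [map_add, MonoidAlgebra.mapDomain_add]

theorem NCPoly.star_zero' : star (0 : NCPoly σ) = 0 := by
  change MonoidAlgebra.mapDomain _ _ = 0
  rw [map_zero, MonoidAlgebra.mapDomain_zero]

instance instStarRingNCPoly : StarRing (NCPoly σ) where
  star_involutive p := by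
    induction p using MonoidAlgebra.induction_linear with
    | zero => rw [NCPoly.star_zero', NCPoly.star_zero']
    | add p q hp hq => rw [NCPoly.star_add', NCPoly.star_add', hp, hq]
    | single w a => rw [NCPoly.star_single, NCPoly.star_single, star_star, star_star]
  star_mul p q := by
    induction p using MonoidAlgebra.induction_linear with
    | zero => rw [zero_mul, NCPoly.star_zero', mul_zero]
    | add p p' hp hp' => rw [add_mul, NCPoly.star_add', NCPoly.star_add', mul_add, hp, hp']
    | single w a =>
      induction q using MonoidAlgebra.induction_linear with
      | zero => rw [mul_zero, NCPoly.star_zero', zero_mul]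
      | add q q' hq hq' => rw [mul_add, NCPoly.star_add', NCPoly.star_add', add_mul, hq, hq']
      | single v b =>
        simp only [MonoidAlgebra.single_mul_single, NCPoly.star_single, star_mul]
  star_add := NCPoly.star_add'

instance instStarModuleNCPoly : StarModule ℂ (NCPoly σ) where
  star_smul a p := by
    induction p using MonoidAlgebra.induction_linear with
    | zero => rw [smul_zero, NCPoly.star_zero', smul_zero]
    | add p q hp hq => rw [smul_add, NCPoly.star_add', NCPoly.star_add', smul_add, hp, hq]
    | single w b =>
      rw [MonoidAlgebra.smul_single, NCPoly.star_single, NCPoly.star_single,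
        MonoidAlgebra.smul_single, smul_eq_mul, smul_eq_mul, star_mul']

theorem star_word_ne_one {w : FreeMonoid σ} (hw : w ≠ 1) : star w ≠ 1 :=
  fun h => hw (by rw [← star_star w, h, FreeMonoid.star_one])

/-- The conjugate-linear ring endomorphism of the state polynomials with `ς(w) ↦ ς(w*)`. -/
def StatePoly.conj : StatePoly σ →+* StatePoly σ :=
  MvPolynomial.eval₂Hom (MvPolynomial.C.comp (starRingEnd ℂ))
    (fun w => MvPolynomial.X ⟨star w.1, star_word_ne_one w.2⟩)

theorem StatePoly.conj_conj (s : StatePoly σ) : StatePoly.conj (StatePoly.conj s) = s := by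
  induction s using MvPolynomial.induction_on with
  | C a => simp [StatePoly.conj]
  | add p q hp hq => rw [map_add, map_add, hp, hq]
  | mul_X p w hp => rw [map_mul, map_mul, hp]; simp [StatePoly.conj]

/-- The involution on state polynomials. -/
instance instStarRingStatePoly : StarRing (StatePoly σ) where
  star := StatePoly.conj
  star_involutive := StatePoly.conj_conj
  star_mul p q := by rw [map_mul, mul_comm]
  star_add p q := map_add _ p q

instance instStarModuleStatePoly : StarModule ℂ (StatePoly σ) where
  star_smul a p := by
    change StatePoly.conj (a • p) = star a • StatePoly.conj p
    rw [MvPolynomial.smul_eq_C_mul, MvPolynomial.smul_eq_C_mul, map_mul]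
    simp [StatePoly.conj]

end Involutions

/-- Noncommutative state polynomials: the `*`-algebra tensor product of the state polynomials and
the noncommutative polynomials over `ℂ`, with Mathlib's involution `(s ⊗ p)* = s* ⊗ p*`. -/
abbrev NCStatePoly (σ : Type) : Type := StatePoly σ ⊗[ℂ] NCPoly σ

section Formal

variable {σ τ : Type}

/-- The free variable `x_j` as a noncommutative state polynomial. -/
def var (j : σ) : NCStatePoly σ :=
  1 ⊗ₜ[ℂ] MonoidAlgebra.of ℂ (FreeMonoid σ) (FreeMonoid.of j)

open Classical in
/-- The formal state symbol on a word: the indeterminate `ς(w)` for `w ≠ 1`, and `ς(1) = 1`. -/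
def wordSymbol (w : FreeMonoid σ) : StatePoly σ :=
  if h : w = 1 then 1 else MvPolynomial.X ⟨w, h⟩

/-- The `ℂ`-linear map `ℂ⟨x⟩ → 𝒮` with `w ↦ ς(w)` on words. -/
def sigmaNC : NCPoly σ →ₗ[ℂ] StatePoly σ :=
  Finsupp.linearCombination ℂ wordSymbol ∘ₗ
    (MonoidAlgebra.coeffLinearEquiv ℂ : NCPoly σ ≃ₗ[ℂ] (FreeMonoid σ →₀ ℂ)).toLinearMap

/-- The `𝒮`-linear unital map `ς : 𝒮⟨x⟩ → 𝒮`, `s ⊗ p ↦ s ς(p)`. -/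
def sigma : NCStatePoly σ →ₗ[StatePoly σ] StatePoly σ :=
  LinearMap.liftBaseChange (StatePoly σ) sigmaNC

theorem map_word_ne_one (g : σ → τ) {w : FreeMonoid σ} (hw : w ≠ 1) :
    FreeMonoid.map g w ≠ 1 := by
  intro h
  exact hw (List.map_eq_nil_iff.mp h)

/-- Substitution of variables `x_j ↦ x_{g j}`, in the free variables and inside `ς`. For injective
`g` it is the inclusion of noncommutative state polynomials into those in more variables. -/
def rename (g : σ → τ) : NCStatePoly σ →ₐ[ℂ] NCStatePoly τ :=
  Algebra.TensorProduct.map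
    (MvPolynomial.rename (fun w : {w : FreeMonoid σ // w ≠ 1} =>
      (⟨FreeMonoid.map g w.1, map_word_ne_one g w.2⟩ : {w : FreeMonoid τ // w ≠ 1})))
    (MonoidAlgebra.mapDomainAlgHom ℂ ℂ (FreeMonoid.map g))

/-- The finite sums `∑ f_j* c_j f_j` with `c_j ∈ {1} ∪ C`. -/
def weightedSquares (C : Set (NCStatePoly σ)) : Set (NCStatePoly σ) :=
  {q | ∃ (m : ℕ) (f c : Fin m → NCStatePoly σ),
    (∀ j, c j = 1 ∨ c j ∈ C) ∧ q = ∑ j, star (f j) * c j * f j}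

/-- The state quadratic module `QM(C)`: the elements `∑ ς(f_j* c_j f_j)` with
`c_j ∈ {1} ∪ C`. -/
def QM (C : Set (NCStatePoly σ)) : Set (StatePoly σ) :=
  {q | ∃ (m : ℕ) (f c : Fin m → NCStatePoly σ),
    (∀ j, c j = 1 ∨ c j ∈ C) ∧ q = ∑ j, sigma (star (f j) * c j * f j)}

/-- `C` is archimedean if `N - ∑ x_j²` is a weighted sum of squares for some `N > 0`. -/
def IsArchimedean [Fintype σ] (C : Set (NCStatePoly σ)) : Prop :=
  ∃ N : ℝ, 0 < N ∧
    algebraMap ℂ (NCStatePoly σ) (N : ℂ) - ∑ j : σ, var j ^ 2 ∈ weightedSquares C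

end Formal

/-! ### States, evaluations, and state semialgebraic sets -/

section Evaluation

variable {σ : Type} {H : Type*} [NormedAddCommGroup H] [InnerProductSpace ℂ H] [CompleteSpace H]

variable (H) in
/-- States on `𝓑(H)`: positive unital linear functionals `𝓑(H) → ℂ`. -/
abbrev OperatorState : Type _ := {φ : (H →L[ℂ] H) →ₚ[ℂ] ℂ // φ 1 = 1}

/-- Evaluation of a state polynomial: `ς(w) ↦ φ(w(X))`. -/
def evalState (φ : OperatorState H) (X : σ → (H →L[ℂ] H)) : StatePoly σ →ₐ[ℂ] ℂ :=
  MvPolynomial.aeval (fun w => φ.1 (FreeMonoid.lift X w.1))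

/-- Evaluation of a noncommutative polynomial: `x_j ↦ X_j`. -/
def evalNC (X : σ → (H →L[ℂ] H)) : NCPoly σ →ₐ[ℂ] (H →L[ℂ] H) :=
  MonoidAlgebra.lift ℂ (H →L[ℂ] H) (FreeMonoid σ) (FreeMonoid.lift X)

/-- State evaluation of a noncommutative state polynomial: `s ⊗ p ↦ s(φ, X) • p(X)`. -/
def eval (φ : OperatorState H) (X : σ → (H →L[ℂ] H)) : NCStatePoly σ →ₐ[ℂ] (H →L[ℂ] H) :=
  Algebra.TensorProduct.lift ((Algebra.ofId ℂ (H →L[ℂ] H)).comp (evalState φ X)) (evalNC X)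
    (fun s p => by
      rw [AlgHom.comp_apply, Algebra.ofId_apply]
      exact Algebra.commute_algebraMap_left (evalState φ X s) (evalNC X p))

variable (H) in
/-- The state semialgebraic set of `C` over `H`: pairs of a state and a tuple of self-adjoint
bounded operators at which all constraints are positive semidefinite. It is `𝒟^∞(C)` when `H` is a
separable infinite-dimensional Hilbert space. -/
def semialgebraicSet (C : Set (NCStatePoly σ)) : Set (OperatorState H × (σ → (H →L[ℂ] H))) :=
  {P | (∀ j, IsSelfAdjoint (P.2 j)) ∧ ∀ c ∈ C, (eval P.1 P.2 c).IsPositive}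

end Evaluation

end StatePolynomials

end

noncomputable section

namespace StatePolynomials

open scoped InnerProductSpace

/-! The symmetry `x_0` turns positivity of an operator into positivity of a single state value. A
state `λ` alone sees only `λ(f)`. If `λ` is the vector state of `v` and a self-adjoint unitary `U`
carries `v` to `w`, then `λ(U f U) = ⟪w, f w⟫`.

(ii) ⇒ (i): let `w` be a unit vector at which `f(λ, X)` fails to be nonnegative. Substitute the
numbers `λ(w(X))` for the state symbols, so that `f` and the constraints become noncommutative
polynomials. Perform GNS simultaneously for `λ` and for countably many copies of the vector state of
`w` (`exists_realization`). The cyclic vectors of different summands are orthogonal, so a reflection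
`U` swaps the first two. The vector state of the first gives the same numbers as `λ`, hence the new
point is feasible. Nonnegativity of its values on the quadratic module and `ε → 0` contradict the
choice of `w`.

(i) ⇒ (ii): the state quadratic module is an archimedean quadratic module in the commutative algebra
of state polynomials. If it omits `ς(x_0 f x_0) + ε`, then separation (`exists_functional`), GNS and
Gelfand theory (`exists_character`) give a character `χ`, nonnegative on the module but not at
`ς(x_0 f x_0)`. The functional `χ ∘ ς` on noncommutative polynomials is positive, and its GNS
representation is a feasible point whose state values are given by `χ`. There `f ⪰ 0` forces
`χ(ς(x_0 f x_0)) ≥ 0`, a contradiction.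

Using a sequence of functionals in GNS makes the space infinite-dimensional, and countable dimension
of the algebras makes it separable, so it can be identified with the given `H`. -/

/-! ### Separable Hilbert spaces and completion of a form inside a prescribed one -/

theorem _root_.Orthonormal.countable_of_separableSpace {K ι : Type*} [NormedAddCommGroup K]
    [InnerProductSpace ℂ K] [TopologicalSpace.SeparableSpace K] {v : ι → K}
    (hv : Orthonormal ℂ v) : Countable ι := by
  -- Orthonormal vectors are at distance `√2 > 1`, so balls of radius `1/2` about them are disjoint.
  refine Pairwise.countable_of_isOpen_disjoint (s := fun i => Metric.ball (v i) (1 / 2))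
    (fun a b hab => ?_) (fun _ => Metric.isOpen_ball) fun i => ⟨v i, by simp⟩
  apply Metric.ball_disjoint_ball
  have h := norm_sub_sq (𝕜 := ℂ) (v a) (v b)
  rw [hv.2 hab, hv.1, hv.1] at h
  norm_num at h
  rw [dist_eq_norm]
  nlinarith [norm_nonneg (v a - v b)]

theorem nonempty_hilbertBasis_nat {K : Type*}
    [NormedAddCommGroup K] [InnerProductSpace ℂ K] [CompleteSpace K]
    [TopologicalSpace.SeparableSpace K] (hK : ¬ FiniteDimensional ℂ K) :
    Nonempty (HilbertBasis ℕ ℂ K) := by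
  obtain ⟨w, b, -⟩ := exists_hilbertBasis ℂ K
  have hc : Countable w := b.orthonormal.countable_of_separableSpace
  have hi : Infinite w := by
    by_contra h
    rw [not_infinite_iff_finite] at h
    have := Fintype.ofFinite w
    exact hK b.toOrthonormalBasis.toBasis.finiteDimensional_of_finite
  have ⟨e⟩ := nonempty_equiv_of_countable (α := ℕ) (β := w)
  refine ⟨HilbertBasis.mk (b.orthonormal.comp e e.injective) ?_⟩
  rw [Set.range_comp, e.range_eq_univ, Set.image_univ, b.dense_span]

/-- Infinite-dimensional separable Hilbert spaces are isometrically isomorphic. -/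
theorem nonempty_linearIsometryEquiv_of_separable {K H : Type*}
    [NormedAddCommGroup K] [InnerProductSpace ℂ K] [CompleteSpace K]
    [TopologicalSpace.SeparableSpace K] (hK : ¬ FiniteDimensional ℂ K)
    [NormedAddCommGroup H] [InnerProductSpace ℂ H] [CompleteSpace H]
    [TopologicalSpace.SeparableSpace H] (hH : ¬ FiniteDimensional ℂ H) :
    Nonempty (K ≃ₗᵢ[ℂ] H) := by
  obtain ⟨b⟩ := nonempty_hilbertBasis_nat hK
  obtain ⟨b'⟩ := nonempty_hilbertBasis_nat hH
  exact ⟨b.repr.trans b'.repr.symm⟩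

/-- The completion of `V` is separable because of the countable spanning set and
infinite-dimensional because of the orthonormal sequence `e`, hence isometric to `H`. The form may
be degenerate, so `j` need not be injective. -/
theorem exists_denseRange_of_preInnerProductSpaceCore {V H : Type*} [AddCommGroup V] [Module ℂ V]
    (core : PreInnerProductSpace.Core ℂ V) (S : Set V) (hS : S.Countable)
    (hspan : Submodule.span ℂ S = ⊤) (e : ℕ → V)
    (he : ∀ i k, core.inner (e i) (e k) = if i = k then 1 else 0)
    [NormedAddCommGroup H] [InnerProductSpace ℂ H] [CompleteSpace H]
    [TopologicalSpace.SeparableSpace H] (hH : ¬ FiniteDimensional ℂ H) :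
    ∃ j : V →ₗ[ℂ] H, DenseRange j ∧ ∀ u v, ⟪j u, j v⟫_ℂ = core.inner u v := by
  let _ : SeminormedAddCommGroup V := @InnerProductSpace.Core.toSeminormedAddCommGroup ℂ V _ _ _ core
  let _ : InnerProductSpace ℂ V := InnerProductSpace.ofCore core
  let K := UniformSpace.Completion V
  let i : V →ₗᵢ[ℂ] K := UniformSpace.Completion.toComplₗᵢ
  have hi : DenseRange i := UniformSpace.Completion.denseRange_coe
  have hinner : ∀ u v : V, ⟪i u, i v⟫_ℂ = core.inner u v := fun u v =>
    (UniformSpace.Completion.inner_coe u v)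
  have : TopologicalSpace.SeparableSpace V := by
    rw [← TopologicalSpace.isSeparable_univ_iff, ← Submodule.top_coe (R := ℂ), ← hspan]
    exact hS.isSeparable.span
  have : TopologicalSpace.SeparableSpace K := hi.separableSpace i.continuous
  have hK : ¬ FiniteDimensional ℂ K := by
    intro hfin
    have hon : Orthonormal ℂ (fun k => i (e k)) := by
      rw [orthonormal_iff_ite]
      intro a b
      rw [hinner, he]
    exact not_finite_iff_infinite.2 inferInstance hon.linearIndependent.finite
  obtain ⟨U⟩ := nonempty_linearIsometryEquiv_of_separable hK hH
  refine ⟨U.toLinearEquiv.toLinearMap ∘ₗ i.toLinearMap, ?_, fun u v => ?_⟩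
  · exact U.surjective.denseRange.comp hi U.continuous
  · change ⟪U (i u), U (i v)⟫_ℂ = _
    rw [U.inner_map_map, hinner]

/-! ### The GNS construction for a sequence of functionals -/

section GNS

variable {A : Type*} [Ring A] [Algebra ℂ A]

/-- Left multiplication on finitely supported sequences. -/
def leftMul (a : A) : (ℕ →₀ A) →ₗ[ℂ] (ℕ →₀ A) :=
  Finsupp.mapRange.linearMap (LinearMap.mulLeft ℂ a)

@[simp] theorem leftMul_apply (a : A) (u : ℕ →₀ A) (k : ℕ) : leftMul a u k = a * u k := by
  simp [leftMul]

theorem support_leftMul_subset (a : A) (u : ℕ →₀ A) : (leftMul a u).support ⊆ u.support := by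
  intro k hk
  rw [Finsupp.mem_support_iff, leftMul_apply] at hk
  exact Finsupp.mem_support_iff.2 fun h => hk (by rw [h, mul_zero])

variable [StarRing A]

/-- A positive functional on a unital `*`-algebra is hermitian. -/
theorem map_star_of_forall_nonneg [StarModule ℂ A] (l : A →ₗ[ℂ] ℂ)
    (hpos : ∀ a, 0 ≤ l (star a * a)) (a : A) :
    l (star a) = star (l a) := by
  -- Polarization: the values at squares have no imaginary part. The choice `1 + a` compares the
  -- imaginary parts of `l a` and `l (star a)`, and `1 + i a` their real parts.
  have h0 := (Complex.le_def.1 (hpos a)).2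
  have h1 := (Complex.le_def.1 (hpos 1)).2
  have h2 := (Complex.le_def.1 (hpos (1 + a))).2
  have h3 := (Complex.le_def.1 (hpos (1 + Complex.I • a))).2
  simp only [star_one, one_mul, mul_one, star_add, add_mul, mul_add, map_add, star_smul, map_smul,
    smul_mul_assoc, mul_smul_comm, smul_eq_mul, Complex.add_im, Complex.mul_im,
    Complex.zero_im, Complex.star_def, Complex.conj_I, Complex.mul_re, Complex.neg_re,
    Complex.neg_im, Complex.I_re, Complex.I_im] at h0 h1 h2 h3
  apply Complex.ext
  · simp; linarith
  · simp; linarith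

/-- The direct sum of the sesquilinear forms of a sequence of functionals. -/
def gnsForm (l : ℕ → A →ₗ[ℂ] ℂ) (u v : ℕ →₀ A) : ℂ :=
  v.sum fun k b => l k (star (u k) * b)

theorem gnsForm_eq_sum (l : ℕ → A →ₗ[ℂ] ℂ) (u v : ℕ →₀ A) (s : Finset ℕ)
    (hs : v.support ⊆ s) : gnsForm l u v = ∑ k ∈ s, l k (star (u k) * v k) :=
  Finsupp.sum_of_support_subset _ hs _ (by simp)

theorem gnsForm_add_left (l : ℕ → A →ₗ[ℂ] ℂ) (u u' v : ℕ →₀ A) :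
    gnsForm l (u + u') v = gnsForm l u v + gnsForm l u' v := by
  simp [gnsForm, Finsupp.sum, add_mul, Finset.sum_add_distrib]

theorem gnsForm_smul_left [StarModule ℂ A] (l : ℕ → A →ₗ[ℂ] ℂ) (u v : ℕ →₀ A) (r : ℂ) :
    gnsForm l (r • u) v = star r * gnsForm l u v := by
  simp [gnsForm, Finsupp.sum, Finset.mul_sum]

theorem gnsForm_nonneg {l : ℕ → A →ₗ[ℂ] ℂ} (hpos : ∀ k a, 0 ≤ l k (star a * a)) (u : ℕ →₀ A) :
    0 ≤ gnsForm l u u :=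
  Finset.sum_nonneg fun k _ => hpos k (u k)

/-- The pre-inner product defined by a sequence of positive functionals. -/
abbrev gnsCore [StarModule ℂ A] (l : ℕ → A →ₗ[ℂ] ℂ) (hpos : ∀ k a, 0 ≤ l k (star a * a)) :
    PreInnerProductSpace.Core ℂ (ℕ →₀ A) where
  inner := gnsForm l
  conj_inner_symm u v := by
    rw [gnsForm_eq_sum l u v _ Finset.subset_union_right,
      gnsForm_eq_sum l v u (u.support ∪ v.support) Finset.subset_union_left, map_sum]
    refine Finset.sum_congr rfl fun k _ => ?_
    rw [starRingEnd_apply, ← map_star_of_forall_nonneg (l k) (hpos k), star_mul, star_star]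
  re_inner_nonneg u := (Complex.le_def.1 (gnsForm_nonneg hpos u)).1
  add_left := gnsForm_add_left l
  smul_left u v r := gnsForm_smul_left l u v r

theorem gnsForm_leftMul (l : ℕ → A →ₗ[ℂ] ℂ) (a : A) (u v : ℕ →₀ A) :
    gnsForm l u (leftMul a v) = ∑ k ∈ v.support, l k (star (u k) * a * v k) := by
  rw [gnsForm_eq_sum l u _ v.support (support_leftMul_subset a v)]
  simp only [leftMul_apply, mul_assoc]

theorem gnsForm_leftMul_left (l : ℕ → A →ₗ[ℂ] ℂ) (a : A) (u v : ℕ →₀ A) :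
    gnsForm l (leftMul a u) v = gnsForm l u (leftMul (star a) v) := by
  rw [gnsForm_leftMul]
  simp [gnsForm, Finsupp.sum]

/-- The Gelfand–Naimark–Segal construction for a sequence of positive functionals with bounded left
multiplications, carried out in a prescribed Hilbert space. -/
theorem exists_gns [StarModule ℂ A] {H : Type*} [NormedAddCommGroup H] [InnerProductSpace ℂ H]
    [CompleteSpace H]
    [TopologicalSpace.SeparableSpace H] (hH : ¬ FiniteDimensional ℂ H)
    (hA : ∃ S : Set A, S.Countable ∧ Submodule.span ℂ S = ⊤)
    (l : ℕ → A →ₗ[ℂ] ℂ) (hpos : ∀ k a, 0 ≤ l k (star a * a)) (hone : ∀ k, l k 1 = 1)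
    (hbdd : ∀ a, ∃ N : ℝ, ∀ k b, l k (star b * (star a * a) * b) ≤ N * l k (star b * b)) :
    ∃ (π : A →⋆ₐ[ℂ] (H →L[ℂ] H)) (j : (ℕ →₀ A) →ₗ[ℂ] H), DenseRange j ∧
      (∀ u v, ⟪j u, j v⟫_ℂ = gnsForm l u v) ∧ ∀ a u, π a (j u) = j (leftMul a u) := by
  obtain ⟨S, hSc, hS⟩ := hA
  obtain ⟨j, hj, hinner⟩ := exists_denseRange_of_preInnerProductSpaceCore (gnsCore l hpos)
    (⋃ k, Finsupp.lsingle (R := ℂ) k '' S) (Set.countable_iUnion fun k => hSc.image _)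
    (by
      rw [Submodule.span_iUnion, ← Finsupp.iSup_lsingle_range]
      exact iSup_congr fun k => by rw [Submodule.span_image, hS, Submodule.map_top])
    (fun k => Finsupp.single k 1)
    (fun i k => by
      change gnsForm l _ _ = _
      rw [gnsForm, Finsupp.sum_single_index (by simp)]
      by_cases h : i = k
      · subst h; simp [hone]
      · simp [h]) hH
  replace hinner : ∀ u v, ⟪j u, j v⟫_ℂ = gnsForm l u v := hinner
  have hnorm : ∀ a, ∃ N, ∀ u, ‖(j ∘ₗ leftMul a) u‖ ≤ N * ‖j u‖ := by
    intro a
    obtain ⟨N, hN⟩ := hbdd a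
    -- `N` bounds squared norms and is not assumed nonnegative, hence the truncation under the root.
    refine ⟨Real.sqrt (max N 0), fun u => ?_⟩
    have h1 : ((‖j (leftMul a u)‖ ^ 2 : ℝ) : ℂ) ≤ ((N * ‖j u‖ ^ 2 : ℝ) : ℂ) := by
      push_cast
      have e := fun x : H => inner_self_eq_norm_sq_to_K (𝕜 := ℂ) x
      simp only [Complex.coe_algebraMap] at e
      rw [← e, ← e, hinner, hinner, gnsForm_eq_sum l _ _ _ (support_leftMul_subset a u),
        gnsForm_eq_sum l u u _ subset_rfl, Finset.mul_sum]
      refine Finset.sum_le_sum fun k _ => ?_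
      simpa only [leftMul_apply, star_mul, mul_assoc] using hN k (u k)
    rw [Complex.real_le_real] at h1
    refine abs_le_of_sq_le_sq' ?_ (by positivity) |>.2
    rw [mul_pow, Real.sq_sqrt (le_max_right _ _)]
    exact h1.trans (mul_le_mul_of_nonneg_right (le_max_left _ _) (by positivity))
  -- Left multiplication is extended by continuity from the dense range of `j`. The bound `hnorm`
  -- also makes it well defined modulo the kernel of `j`.
  let T : A → (H →L[ℂ] H) := fun a => (j ∘ₗ leftMul a).extendOfNorm j
  have hT : ∀ a u, T a (j u) = j (leftMul a u) := fun a u =>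
    LinearMap.extendOfNorm_eq hj (hnorm a) u
  have hext : ∀ B B' : H →L[ℂ] H, (∀ u, B (j u) = B' (j u)) → B = B' := fun B B' h =>
    ContinuousLinearMap.coeFn_injective (hj.equalizer B.continuous B'.continuous (funext h))
  refine ⟨{
    toFun := T
    map_one' := hext _ _ fun u => ?_
    map_mul' := fun a b => hext _ _ fun u => ?_
    map_zero' := hext _ _ fun u => ?_
    map_add' := fun a b => hext _ _ fun u => ?_
    commutes' := fun r => hext _ _ fun u => ?_
    map_star' := fun a => ?_ }, j, hj, hinner, hT⟩
  · rw [hT]; exact congrArg j (by ext; simp)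
  · rw [hT, mul_apply_eq_comp, hT, hT]; exact congrArg j (by ext; simp [mul_assoc])
  · rw [hT, zero_apply, ← map_zero j]; exact congrArg j (by ext; simp)
  · rw [hT, add_apply, hT, hT, ← map_add]
    exact congrArg j (by ext; simp [add_mul])
  · rw [hT, ContinuousLinearMap.algebraMap_apply, ← map_smul]
    exact congrArg j (by ext; simp [Algebra.smul_def])
  · rw [ContinuousLinearMap.star_eq_adjoint, ContinuousLinearMap.eq_adjoint_iff]
    refine fun x y => ?_
    refine hj.induction_on₂ (p := fun x y => ⟪T (star a) x, y⟫_ℂ = ⟪x, T a y⟫_ℂ)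
      (isClosed_eq (by fun_prop) (by fun_prop)) (fun u v => ?_) x y
    rw [hT, hT, hinner, hinner, gnsForm_leftMul_left, star_star]

end GNS

/-! ### Substituting numbers for the state symbols -/

section Specialization

variable {σ : Type}

/-- Substitution of scalars for the state symbols of a noncommutative state polynomial. -/
def specialize (χ : StatePoly σ →ₐ[ℂ] ℂ) : NCStatePoly σ →ₐ[ℂ] NCPoly σ :=
  Algebra.TensorProduct.lift ((Algebra.ofId ℂ (NCPoly σ)).comp χ) (AlgHom.id ℂ _)
    (fun s p => by
      rw [AlgHom.comp_apply, Algebra.ofId_apply]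
      exact Algebra.commute_algebraMap_left (χ s) p)

@[simp] theorem specialize_tmul (χ : StatePoly σ →ₐ[ℂ] ℂ) (s : StatePoly σ) (p : NCPoly σ) :
    specialize χ (s ⊗ₜ p) = χ s • p := by
  rw [specialize, Algebra.TensorProduct.lift_tmul, AlgHom.comp_apply, Algebra.ofId_apply,
    ← Algebra.smul_def, AlgHom.id_apply]

theorem sigma_tmul (s : StatePoly σ) (p : NCPoly σ) : sigma (s ⊗ₜ[ℂ] p) = s * sigmaNC p := by
  simp [sigma]

theorem sigmaNC_single (w : FreeMonoid σ) (a : ℂ) :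
    sigmaNC (MonoidAlgebra.single w a) = a • wordSymbol w := by
  simp [sigmaNC]

theorem sigmaNC_one : sigmaNC (1 : NCPoly σ) = 1 := by
  rw [MonoidAlgebra.one_def, sigmaNC_single, one_smul, wordSymbol, dif_pos rfl]

/-- Reduces positivity of `χ ∘ sigma` to positivity of the functional `χ ∘ sigmaNC` on
noncommutative polynomials, where GNS applies. -/
theorem map_sigma (χ : StatePoly σ →ₐ[ℂ] ℂ) (g : NCStatePoly σ) :
    χ (sigma g) = χ (sigmaNC (specialize χ g)) := by
  induction g using TensorProduct.induction_on with
  | zero => simp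
  | tmul s p => simp [sigma_tmul]
  | add x y hx hy => simp only [map_add, hx, hy]

theorem span_of_eq_top : Submodule.span ℂ (Set.range (MonoidAlgebra.of ℂ (FreeMonoid σ))) = ⊤ := by
  refine eq_top_iff.2 fun p _ => ?_
  induction p using MonoidAlgebra.induction_linear with
  | zero => exact zero_mem _
  | add p q hp hq => exact add_mem (hp trivial) (hq trivial)
  | single w a =>
    have : (MonoidAlgebra.single w a : NCPoly σ) = a • MonoidAlgebra.of ℂ (FreeMonoid σ) w := by
      simp
    rw [this]
    exact Submodule.smul_mem _ _ (Submodule.subset_span ⟨w, rfl⟩)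

theorem exists_countable_span_eq_top [Countable σ] :
    ∃ S : Set (NCPoly σ), S.Countable ∧ Submodule.span ℂ S = ⊤ := by
  have : Countable (FreeMonoid σ) := inferInstanceAs (Countable (List σ))
  exact ⟨_, Set.countable_range _, span_of_eq_top⟩

end Specialization

/-! ### Evaluations, and realizing functionals by operators on `H` -/

section Realization

variable {σ : Type} {H : Type*} [NormedAddCommGroup H] [InnerProductSpace ℂ H]

theorem evalNC_of (X : σ → (H →L[ℂ] H)) (j : σ) :
    evalNC X (MonoidAlgebra.of ℂ (FreeMonoid σ) (FreeMonoid.of j)) = X j := by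
  simp [evalNC]

theorem eval_tmul (φ : OperatorState H) (X : σ → (H →L[ℂ] H)) (s : StatePoly σ) (p : NCPoly σ) :
    eval φ X (s ⊗ₜ p) = evalState φ X s • evalNC X p := by
  simp [eval, Algebra.ofId_apply, Algebra.smul_def]

theorem eval_eq_evalNC_specialize (φ : OperatorState H) (X : σ → (H →L[ℂ] H))
    (g : NCStatePoly σ) : eval φ X g = evalNC X (specialize (evalState φ X) g) := by
  induction g using TensorProduct.induction_on with
  | zero => simp
  | tmul s p => simp [eval_tmul]
  | add x y hx hy => simp only [map_add, hx, hy]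

theorem evalState_sigmaNC (φ : OperatorState H) (X : σ → (H →L[ℂ] H)) (p : NCPoly σ) :
    evalState φ X (sigmaNC p) = φ.1 (evalNC X p) := by
  induction p using MonoidAlgebra.induction_linear with
  | zero => simp
  | add p q hp hq => simp only [map_add, hp, hq]
  | single w a =>
    rw [sigmaNC_single, map_smul, evalNC, MonoidAlgebra.lift_single, map_smul, wordSymbol]
    split_ifs with h
    · rw [h, map_one, map_one, φ.2]
    · simp [evalState]

theorem evalState_sigma (φ : OperatorState H) (X : σ → (H →L[ℂ] H)) (g : NCStatePoly σ) :
    evalState φ X (sigma g) = φ.1 (eval φ X g) := by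
  rw [map_sigma, evalState_sigmaNC, eval_eq_evalNC_specialize]

theorem isPositive_iff_forall_inner_nonneg (T : H →L[ℂ] H) :
    T.IsPositive ↔ ∀ x, 0 ≤ ⟪x, T x⟫_ℂ := by
  refine ⟨fun h x => h.inner_nonneg_right x, fun h => ?_⟩
  rw [ContinuousLinearMap.isPositive_iff_complex]
  intro x
  have h1 : 0 ≤ ⟪T x, x⟫_ℂ := by
    rw [← inner_conj_symm]
    exact star_nonneg_iff.2 (h x)
  exact ⟨Complex.ext (by simp) (by simpa using (Complex.le_def.1 h1).2), (Complex.le_def.1 h1).1⟩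

theorem isPositive_of_denseRange {V : Type*} {j : V → H} (hj : DenseRange j) {T : H →L[ℂ] H}
    (h : ∀ u, 0 ≤ ⟪j u, T (j u)⟫_ℂ) : T.IsPositive := by
  rw [isPositive_iff_forall_inner_nonneg]
  intro x
  exact hj.induction_on (p := fun x => 0 ≤ ⟪x, T x⟫_ℂ) x
    (isClosed_le continuous_const (by fun_prop)) h

theorem eval_rename {τ : Type} (φ : OperatorState H) (X : τ → (H →L[ℂ] H)) (i : σ → τ)
    (g : NCStatePoly σ) : eval φ X (rename i g) = eval φ (X ∘ i) g := by
  have hw : ∀ w : FreeMonoid σ,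
      FreeMonoid.lift X (FreeMonoid.map i w) = FreeMonoid.lift (X ∘ i) w := by
    intro w
    induction w using FreeMonoid.inductionOn' with
    | one => simp
    | of_mul x w hw => simp only [map_mul, hw]; simp
  have hS : ∀ s : StatePoly σ, evalState φ X (MvPolynomial.rename
      (fun w : {w : FreeMonoid σ // w ≠ 1} =>
        (⟨FreeMonoid.map i w.1, map_word_ne_one i w.2⟩ : {w : FreeMonoid τ // w ≠ 1})) s) =
      evalState φ (X ∘ i) s := by
    intro s
    rw [evalState, MvPolynomial.aeval_rename, evalState]
    congr 2
    funext w
    exact congrArg φ.1 (hw w.1)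
  have hN : ∀ p : NCPoly σ, evalNC X (MonoidAlgebra.mapDomainAlgHom ℂ ℂ (FreeMonoid.map i) p) =
      evalNC (X ∘ i) p := by
    intro p
    induction p using MonoidAlgebra.induction_linear with
    | zero => simp
    | add p q hp hq => simp only [map_add, hp, hq]
    | single w a => simp [evalNC, hw]
  induction g using TensorProduct.induction_on with
  | zero => simp
  | tmul s p => rw [rename, Algebra.TensorProduct.map_tmul, eval_tmul, eval_tmul, hS, hN]
  | add x y hx hy => simp only [map_add, hx, hy]

variable [CompleteSpace H]

theorem evalNC_star {X : σ → (H →L[ℂ] H)} (hX : ∀ j, IsSelfAdjoint (X j)) (p : NCPoly σ) :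
    evalNC X (star p) = star (evalNC X p) := by
  induction p using MonoidAlgebra.induction_linear with
  | zero => simp
  | add p q hp hq => rw [star_add, map_add, hp, hq, map_add, star_add]
  | single w a =>
    rw [NCPoly.star_single]
    simp only [evalNC, MonoidAlgebra.lift_single, star_smul]
    congr 1
    induction w using FreeMonoid.inductionOn' with
    | one => simp
    | of_mul x w hw => rw [star_mul, map_mul, hw, map_mul, star_mul]; simp [(hX x).star_eq]

theorem evalState_star {φ : OperatorState H} {X : σ → (H →L[ℂ] H)}
    (hX : ∀ j, IsSelfAdjoint (X j)) (s : StatePoly σ) :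
    evalState φ X (star s) = star (evalState φ X s) := by
  change evalState φ X (StatePoly.conj s) = _
  induction s using MvPolynomial.induction_on with
  | C a => simp [StatePoly.conj, evalState]
  | add p q hp hq => simp only [map_add, hp, hq, star_add]
  | mul_X p w hp =>
    rw [map_mul, map_mul, hp, map_mul, star_mul']
    congr 1
    have h := evalNC_star hX (MonoidAlgebra.of ℂ (FreeMonoid σ) w.1)
    simp only [MonoidAlgebra.of_apply, NCPoly.star_single, evalNC, MonoidAlgebra.lift_single,
      star_one, one_smul] at h
    simp only [StatePoly.conj, evalState, MvPolynomial.coe_eval₂Hom, MvPolynomial.eval₂_X,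
      MvPolynomial.aeval_X, h]
    exact map_star φ.1 _

theorem eval_star {φ : OperatorState H} {X : σ → (H →L[ℂ] H)}
    (hX : ∀ j, IsSelfAdjoint (X j)) (g : NCStatePoly σ) :
    eval φ X (star g) = star (eval φ X g) := by
  induction g using TensorProduct.induction_on with
  | zero => simp
  | tmul s p =>
    rw [TensorProduct.star_tmul, eval_tmul, eval_tmul, evalState_star hX, evalNC_star hX, star_smul]
  | add x y hx hy => simp only [star_add, map_add, hx, hy]

/-- The vector state of a unit vector. -/
def vectorState (v : H) (hv : ⟪v, v⟫_ℂ = 1) : OperatorState H :=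
  ⟨PositiveLinearMap.mk₀ ((innerSL ℂ v).toLinearMap ∘ₗ
      (ContinuousLinearMap.apply ℂ H v).toLinearMap) fun T hT =>
    ((ContinuousLinearMap.nonneg_iff_isPositive T).1 hT).inner_nonneg_right v, hv⟩

theorem vectorState_apply (v : H) (hv : ⟪v, v⟫_ℂ = 1) (T : H →L[ℂ] H) :
    (vectorState v hv).1 T = ⟪v, T v⟫_ℂ := rfl

/-- The GNS direct sum of the `l k`, with cyclic vectors `v k`. Only `l 0` must be compatible with
`χ`, since the state is the vector state of `v 0`. The other summands contribute further orthonormal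
vectors without changing any state value. -/
theorem exists_realization [Countable σ] [TopologicalSpace.SeparableSpace H]
    (hH : ¬ FiniteDimensional ℂ H) (χ : StatePoly σ →ₐ[ℂ] ℂ) (l : ℕ → NCPoly σ →ₗ[ℂ] ℂ)
    (hpos : ∀ k p, 0 ≤ l k (star p * p)) (hone : ∀ k, l k 1 = 1)
    (hbdd : ∀ p, ∃ N : ℝ, ∀ k q, l k (star q * (star p * p) * q) ≤ N * l k (star q * q))
    (hzero : ∀ p, l 0 p = χ (sigmaNC p)) :
    ∃ (φ : OperatorState H) (X : σ → (H →L[ℂ] H)) (v : ℕ → H),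
      (∀ T, φ.1 T = ⟪v 0, T (v 0)⟫_ℂ) ∧ (∀ j, IsSelfAdjoint (X j)) ∧
      (∀ i k, ⟪v i, v k⟫_ℂ = if i = k then 1 else 0) ∧ (∀ s, evalState φ X s = χ s) ∧
      (∀ k g, ⟪v k, eval φ X g (v k)⟫_ℂ = l k (specialize χ g)) ∧
      ∀ c, (∀ k p, 0 ≤ l k (star p * specialize χ c * p)) → (eval φ X c).IsPositive := by
  obtain ⟨π, j, hj, hinner, hπ⟩ := exists_gns hH exists_countable_span_eq_top l hpos hone hbdd
  let X : σ → (H →L[ℂ] H) := fun i => π (MonoidAlgebra.of ℂ (FreeMonoid σ) (FreeMonoid.of i))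
  have hX : ∀ i, IsSelfAdjoint (X i) := by
    intro i
    rw [IsSelfAdjoint, ← map_star, MonoidAlgebra.of_apply, NCPoly.star_single, star_one,
      FreeMonoid.star_of]
    rfl
  have hπX : ∀ p, evalNC X p = π p := by
    intro p
    suffices evalNC X = π.toAlgHom from DFunLike.congr_fun this p
    refine MonoidAlgebra.algHom_ext' (FreeMonoid.hom_eq fun i => ?_) (Subsingleton.elim _ _)
    exact evalNC_of X i
  let v : ℕ → H := fun k => j (Finsupp.single k 1)
  have hv : ∀ i k, ⟪v i, v k⟫_ℂ = if i = k then 1 else 0 := by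
    intro i k
    rw [hinner, gnsForm, Finsupp.sum_single_index (by simp)]
    by_cases h : i = k
    · subst h; simp [hone]
    · simp [h]
  have hvl : ∀ k p, ⟪v k, π p (v k)⟫_ℂ = l k p := by
    intro k p
    rw [hπ, hinner, gnsForm_eq_sum l _ _ {k}
      ((support_leftMul_subset _ _).trans Finsupp.support_single_subset)]
    simp
  let φ : OperatorState H := vectorState (v 0) (by rw [hv, if_pos rfl])
  have hχ : ∀ s, evalState φ X s = χ s := by
    -- Both sides are algebra homomorphisms, so the generators `ς(w)` suffice; there the vector
    -- state of `v 0` gives `l 0`.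
    refine fun s => DFunLike.congr_fun (MvPolynomial.algHom_ext fun w => ?_) s
    have h1 := evalState_sigmaNC φ X (MonoidAlgebra.single w.1 1)
    rw [vectorState_apply, hπX, hvl, hzero, sigmaNC_single, one_smul, wordSymbol, dif_neg w.2] at h1
    exact h1
  have heval : ∀ g, eval φ X g = π (specialize χ g) := by
    intro g
    rw [eval_eq_evalNC_specialize, hπX, show evalState φ X = χ from AlgHom.ext hχ]
  refine ⟨φ, X, v, fun T => rfl, hX, hv, hχ, fun k g => by rw [heval, hvl], fun c hc => ?_⟩
  -- The form is diagonal in `k`, so positivity can be checked summand by summand.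
  refine isPositive_of_denseRange hj fun u => ?_
  rw [heval, hπ, hinner, gnsForm_leftMul]
  exact Finset.sum_nonneg fun k _ => hc k (u k)

end Realization

/-! ### Archimedean quadratic modules and separation -/

section QuadraticModules

variable {A : Type*} [Ring A] [StarRing A]

/-- Quadratic modules of self-adjoint elements in a unital `*`-algebra. -/
structure IsQuadraticModule (Q : Set A) : Prop where
  isSelfAdjoint : ∀ q ∈ Q, IsSelfAdjoint q
  one_mem : 1 ∈ Q
  add_mem : ∀ p ∈ Q, ∀ q ∈ Q, p + q ∈ Q
  conj_mem : ∀ a, ∀ q ∈ Q, star a * q * a ∈ Q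

namespace IsQuadraticModule

variable {Q : Set A} (hQ : IsQuadraticModule Q)

include hQ

theorem star_mul_self_mem (a : A) : star a * a ∈ Q := by
  simpa using hQ.conj_mem a 1 hQ.one_mem

theorem zero_mem : (0 : A) ∈ Q := by
  simpa using hQ.star_mul_self_mem 0

variable [Algebra ℂ A]

/-- Elements `a` with `N - a* a` in the quadratic module for some `N`. -/
def _root_.StatePolynomials.IsBoundedBy (Q : Set A) (a : A) : Prop :=
  ∃ N : ℝ, 0 ≤ N ∧ algebraMap ℂ A N - star a * a ∈ Q

theorem isBoundedBy_add {a b : A} (ha : IsBoundedBy Q a) (hb : IsBoundedBy Q b) :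
    IsBoundedBy Q (a + b) := by
  obtain ⟨M, hM, ha⟩ := ha
  obtain ⟨N, hN, hb⟩ := hb
  refine ⟨2 * M + 2 * N, by positivity, ?_⟩
  have h1 := hQ.add_mem _ ha _ hb
  -- Parallelogram law: `(a+b)*(a+b) + (a-b)*(a-b) = 2a*a + 2b*b`.
  convert hQ.add_mem _ (hQ.add_mem _ h1 _ h1) _ (hQ.star_mul_self_mem (a - b)) using 1
  simp only [Complex.ofReal_add, Complex.ofReal_mul, map_add, map_mul, star_add, star_sub,
    Complex.ofReal_ofNat, map_ofNat]
  noncomm_ring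

variable [StarModule ℂ A]

theorem algebraMap_mul_mem {r : ℝ} (hr : 0 ≤ r) {q : A} (hq : q ∈ Q) :
    algebraMap ℂ A r * q ∈ Q := by
  have h := hQ.conj_mem (algebraMap ℂ A (Real.sqrt r)) q hq
  rw [← algebraMap_star_comm, Complex.star_def, Complex.conj_ofReal, mul_assoc,
    ← Algebra.commutes, ← mul_assoc, ← map_mul, ← Complex.ofReal_mul, Real.mul_self_sqrt hr] at h
  exact h

theorem algebraMap_mem {r : ℝ} (hr : 0 ≤ r) : algebraMap ℂ A r ∈ Q := by
  simpa using hQ.algebraMap_mul_mem hr hQ.one_mem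

theorem isBoundedBy_algebraMap (z : ℂ) : IsBoundedBy Q (algebraMap ℂ A z) := by
  refine ⟨Complex.normSq z, Complex.normSq_nonneg z, ?_⟩
  rw [← algebraMap_star_comm, ← map_mul, Complex.star_def, ← Complex.normSq_eq_conj_mul_self,
    sub_self]
  exact hQ.zero_mem

theorem isBoundedBy_mul {a b : A} (ha : IsBoundedBy Q a) (hb : IsBoundedBy Q b) :
    IsBoundedBy Q (a * b) := by
  obtain ⟨M, hM, ha⟩ := ha
  obtain ⟨N, hN, hb⟩ := hb
  refine ⟨M * N, by positivity, ?_⟩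
  -- `MN - b*a*ab = b*(M - a*a)b + M(N - b*b)`.
  convert hQ.add_mem _ (hQ.conj_mem b _ ha) _ (hQ.algebraMap_mul_mem hM hb) using 1
  rw [mul_sub, sub_mul, ← Algebra.commutes, star_mul, Complex.ofReal_mul, map_mul]
  noncomm_ring

theorem exists_algebraMap_add_mem {a : A} (hsa : IsSelfAdjoint a) (ha : IsBoundedBy Q a) :
    ∃ N : ℝ, algebraMap ℂ A N + a ∈ Q := by
  obtain ⟨N, hN, ha⟩ := ha
  -- From `(1 + a)² + (N - a²) = (1 + N) + 2a`.
  refine ⟨(1 + N) / 2, ?_⟩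
  convert hQ.algebraMap_mul_mem (r := 1 / 2) (by norm_num)
    (hQ.add_mem _ (hQ.star_mul_self_mem (1 + a)) _ ha) using 1
  have h2 : algebraMap ℂ A ((1 / 2 : ℝ) : ℂ) * 2 = 1 := by
    rw [← map_ofNat (algebraMap ℂ A) 2, ← map_mul]
    norm_num
  rw [star_add, star_one, hsa.star_eq,
    show (1 + a) * (1 + a) + (algebraMap ℂ A N - a * a) = 2 * a + algebraMap ℂ A ((1 + N : ℝ) : ℂ) by
      rw [Complex.ofReal_add, map_add, Complex.ofReal_one, map_one]; noncomm_ring,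
    mul_add, ← mul_assoc, h2, one_mul, ← map_mul, add_comm]
  congr 2
  push_cast
  ring

theorem mem_of_neg_one_mem (h : (-1 : A) ∈ Q) {a : A} (ha : IsSelfAdjoint a) : a ∈ Q := by
  -- `4a = (a + 1)² - (a - 1)²`.
  have h1 := hQ.add_mem _ (hQ.star_mul_self_mem (a + 1)) _ (hQ.conj_mem (a - 1) _ h)
  have h4 : algebraMap ℂ A ((1 / 4 : ℝ) : ℂ) * 4 = 1 := by
    rw [← map_ofNat (algebraMap ℂ A) 4, ← map_mul]
    norm_num
  convert hQ.algebraMap_mul_mem (r := 1 / 4) (by norm_num) h1 using 1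
  rw [star_add, star_sub, star_one, ha.star_eq,
    show (a + 1) * (a + 1) + (a - 1) * -1 * (a - 1) = 4 * a by noncomm_ring, ← mul_assoc, h4,
    one_mul]

/-- Separation of a self-adjoint element from an archimedean quadratic module. -/
theorem exists_functional (hb : ∀ a, IsBoundedBy Q a) {g : A} (hg : IsSelfAdjoint g)
    (hgQ : g ∉ Q) :
    ∃ l : A →ₗ[ℂ] ℂ, l 1 = 1 ∧ (∀ q ∈ Q, 0 ≤ l q) ∧ l g ≤ 0 := by
  have hsmul : ∀ (r : ℝ) (a : A), r • a = algebraMap ℂ A r * a := fun r a => by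
    rw [← Complex.coe_smul, Algebra.smul_def]
  -- The cone contains `Q`, `-g` and all skew-adjoint elements. A real functional nonnegative on it
  -- is therefore nonnegative on `Q`, nonpositive at `g` and zero on skew elements.
  let K : PointedCone ℝ A :=
    { carrier := {a | ∃ q ∈ Q, ∃ t : ℝ, 0 ≤ t ∧ a + star a = q - t • g}
      add_mem' := by
        rintro a b ⟨p, hp, s, hs, ha⟩ ⟨q, hq, t, ht, hb⟩
        refine ⟨_, hQ.add_mem _ hp _ hq, s + t, by positivity, ?_⟩
        rw [star_add, add_add_add_comm, ha, hb, add_smul]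
        abel
      zero_mem' := ⟨0, hQ.zero_mem, 0, le_rfl, by simp⟩
      smul_mem' := by
        rintro ⟨r, hr⟩ a ⟨q, hq, t, ht, ha⟩
        refine ⟨r • q, by rw [hsmul]; exact hQ.algebraMap_mul_mem hr hq, r * t, by positivity, ?_⟩
        change r • a + star (r • a) = _
        rw [hsmul r a, star_mul, ← algebraMap_star_comm, Complex.star_def, Complex.conj_ofReal,
          ← Algebra.commutes, ← hsmul, ← hsmul, ← smul_add, ha, smul_sub, smul_smul] }
  have hone : (1 : A) ≠ 0 := by
    intro h
    have : g = 0 := by rw [← mul_one g, h, mul_zero]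
    exact hgQ (this ▸ hQ.zero_mem)
  have hneg : (-1 : A) ∉ Q := fun h => hgQ (hQ.mem_of_neg_one_mem h hg)
  have hf : ∀ (r : ℝ) (h), LinearPMap.mkSpanSingleton (1 : A) (1 : ℝ) hone ⟨r • 1, h⟩ = r :=
    fun r h => 
      (LinearPMap.mkSpanSingleton'_apply (σ := RingHom.id ℝ) (1 : A) (1 : ℝ) _ r h).trans
        (mul_one r)
  have hstar : ∀ r : ℝ, star (r • (1 : A)) = r • 1 := fun r => by
    rw [hsmul, mul_one, ← algebraMap_star_comm, Complex.star_def, Complex.conj_ofReal]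
  have hsmulQ : ∀ r : ℝ, 0 ≤ r → ∀ q ∈ Q, r • q ∈ Q := fun r hr q hq => by
    rw [hsmul]
    exact hQ.algebraMap_mul_mem hr hq
  obtain ⟨L, hL1, hLK⟩ := riesz_extension K (LinearPMap.mkSpanSingleton (1 : A) (1 : ℝ) hone)
    (by
      rintro ⟨x, hx⟩ hxK
      obtain ⟨r, rfl⟩ := Submodule.mem_span_singleton.1 hx
      rw [hf]
      obtain ⟨q, hq, t, ht, h⟩ := hxK
      -- If `r < 0` and `2r = q - t g`, then `t = 0` puts `-1` in `Q`, hence also `g`, while `t > 0`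
      -- puts `g = t⁻¹(q - 2r)` in `Q`.
      by_contra! hr
      replace h : q = t • g + (2 * r) • (1 : A) := by
        rw [two_mul, add_smul]
        nth_rewrite 2 [← hstar r]
        rw [h]
        abel
      rcases ht.eq_or_lt with rfl | ht
      · refine hneg ?_
        convert hsmulQ (-(2 * r))⁻¹ (inv_nonneg.2 (by linarith)) q hq using 1
        rw [h, zero_smul, zero_add, smul_smul, inv_neg, neg_mul, inv_mul_cancel₀ (by linarith),
          neg_one_smul]
      · refine hgQ ?_
        convert hsmulQ t⁻¹ (inv_nonneg.2 ht.le) _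
          (hQ.add_mem _ hq _ (hsmulQ (-(2 * r)) (by linarith) 1 hQ.one_mem)) using 1
        rw [h, neg_smul, add_neg_cancel_right, smul_smul, inv_mul_cancel₀ ht.ne', one_smul])
    (by
      intro y
      have hy : IsSelfAdjoint (y + star y) := IsSelfAdjoint.add_star_self y
      -- The archimedean property supplies the cofinality needed for the Riesz extension: `N/2 + y`
      -- lies in `K`.
      obtain ⟨N, hN⟩ := hQ.exists_algebraMap_add_mem hy (hb _)
      refine ⟨⟨(N / 2) • 1, Submodule.smul_mem _ _ (Submodule.mem_span_singleton_self _)⟩,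
        _, hN, 0, le_rfl, ?_⟩
      rw [star_add, hstar, zero_smul, sub_zero, ← mul_one (algebraMap ℂ A N), ← hsmul,
        add_add_add_comm, ← add_smul, add_halves])
  have hskew : ∀ a, star a = -a → L a = 0 := by
    intro a ha
    have h1 := hLK a ⟨0, hQ.zero_mem, 0, le_rfl, by rw [ha]; simp⟩
    have h2 := hLK (-a) ⟨0, hQ.zero_mem, 0, le_rfl, by rw [star_neg, ha]; simp⟩
    rw [map_neg] at h2
    linarith
  -- For self-adjoint `a` the element `i a` is skew, so the imaginary part of the complexified
  -- functional vanishes at `a`.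
  have hre : ∀ a, IsSelfAdjoint a → Module.Dual.extendRCLike (𝕜 := ℂ) L a = (L a : ℂ) := by
    intro a ha
    rw [Module.Dual.extendRCLike_apply, hskew (RCLike.I • a)
      (by rw [star_smul, ha.star_eq]; simp)]
    simp
  refine ⟨Module.Dual.extendRCLike L, ?_, fun q hq => ?_, ?_⟩
  · rw [hre _ (.one A)]
    have h := hL1 ⟨(1 : ℝ) • 1, Submodule.smul_mem _ _ (Submodule.mem_span_singleton_self _)⟩
    rw [hf] at h
    replace h : L ((1 : ℝ) • 1) = 1 := h
    rw [one_smul] at h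
    rw [h, Complex.ofReal_one]
  · rw [hre _ (hQ.isSelfAdjoint q hq)]
    exact Complex.zero_le_real.2 (hLK q ⟨q + q, hQ.add_mem _ hq _ hq, 0, le_rfl, by
      rw [(hQ.isSelfAdjoint q hq).star_eq, zero_smul, sub_zero]⟩)
  · rw [hre g hg]
    have := hLK (-g) ⟨0, hQ.zero_mem, 2, by norm_num, by
      rw [star_neg, hg.star_eq, two_smul]; abel⟩
    rw [map_neg] at this
    exact_mod_cast neg_nonneg.1 this

end IsQuadraticModule

end QuadraticModules

/-! ### Characters nonnegative on a commutative quadratic module -/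

theorem isPositive_iff_forall_spectrum {H : Type*} [NormedAddCommGroup H] [InnerProductSpace ℂ H]
    [CompleteSpace H] {T : H →L[ℂ] H} (hT : IsSelfAdjoint T) :
    T.IsPositive ↔ ∀ z ∈ spectrum ℂ T, 0 ≤ z := by
  rw [← ContinuousLinearMap.nonneg_iff_isPositive]
  constructor
  · intro h z hz
    have hz' := hT.mem_spectrum_eq_re hz
    rw [hz'] at hz ⊢
    exact Complex.zero_le_real.2
      (spectrum_nonneg_of_nonneg h ((spectrum.algebraMap_mem_iff ℂ).1 hz))
  · intro h
    rw [nonneg_iff_isSelfAdjoint_and_quasispectrumRestricts]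
    refine ⟨hT, SpectrumRestricts.nnreal_iff.2 fun x hx => ?_⟩
    exact Complex.zero_le_real.1 (h _ ((spectrum.algebraMap_mem_iff ℂ).2 hx))

/-- The archimedean Positivstellensatz for commutative `*`-algebras of countable dimension. -/
theorem IsQuadraticModule.exists_character {A : Type*} [CommRing A] [StarRing A] [Algebra ℂ A]
    [StarModule ℂ A] {H : Type*} [NormedAddCommGroup H] [InnerProductSpace ℂ H] [CompleteSpace H]
    [TopologicalSpace.SeparableSpace H] (hH : ¬ FiniteDimensional ℂ H)
    (hA : ∃ S : Set A, S.Countable ∧ Submodule.span ℂ S = ⊤)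
    {Q : Set A} (hQ : IsQuadraticModule Q) (hb : ∀ a, IsBoundedBy Q a) {g : A}
    (hg : IsSelfAdjoint g) {ε : ℝ} (hε : 0 < ε) (hgQ : g + algebraMap ℂ A ε ∉ Q) :
    ∃ χ : A →ₐ[ℂ] ℂ, (∀ q ∈ Q, 0 ≤ χ q) ∧ ¬ 0 ≤ χ g := by
  have hεsa : IsSelfAdjoint (algebraMap ℂ A ε) :=
    hQ.isSelfAdjoint _ (hQ.algebraMap_mem hε.le)
  obtain ⟨l, hl1, hlQ, hlg⟩ := hQ.exists_functional hb (hg.add hεsa) hgQ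
  obtain ⟨π, j, hj, hinner, hπ⟩ := exists_gns hH hA (fun _ => l)
    (fun _ a => hlQ _ (hQ.star_mul_self_mem a)) (fun _ => hl1) (by
      intro a
      obtain ⟨N, -, hN⟩ := hb a
      refine ⟨N, fun _ b => ?_⟩
      have h := hlQ _ (hQ.conj_mem b _ hN)
      rw [mul_sub, sub_mul, map_sub, sub_nonneg, ← Algebra.commutes, mul_assoc (algebraMap ℂ A N),
        ← Algebra.smul_def, map_smul, smul_eq_mul] at h
      exact h)
  have hπQ : ∀ q ∈ Q, (π q).IsPositive := by
    refine fun q hq => isPositive_of_denseRange hj fun u => ?_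
    rw [hπ, hinner, gnsForm_leftMul]
    exact Finset.sum_nonneg fun k _ => hlQ _ (hQ.conj_mem (u k) q hq)
  -- At the cyclic vector of the summand `0` the quadratic form of `π g` is `l g ≤ -ε`.
  have hπg : ¬ (π g).IsPositive := by
    intro h
    have h1 := h.inner_nonneg_right (j (Finsupp.single 0 1))
    rw [hπ, hinner, gnsForm_eq_sum _ _ _ {0}
      ((support_leftMul_subset _ _).trans Finsupp.support_single_subset)] at h1
    rw [map_add, Algebra.algebraMap_eq_smul_one, map_smul, hl1] at hlg
    simp only [Finset.sum_singleton, Finsupp.single_eq_same, star_one, leftMul_apply, mul_one,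
      one_mul] at h1
    have h2 := (Complex.le_def.1 h1).1
    have h3 := (Complex.le_def.1 hlg).1
    simp at h2 h3
    linarith
  -- `B` is a commutative C*-algebra, and spectra in it agree with spectra in `𝓑(H)`. So each point
  -- of the spectrum of `π g` is the value of a character, and that character is nonnegative on `Q`
  -- because it maps `π q` into the spectrum of a positive operator.
  let B := π.range.topologicalClosure
  have hcomm : ∀ x y : π.range, x * y = y * x := by
    rintro ⟨_, a, rfl⟩ ⟨_, b, rfl⟩
    exact Subtype.ext (by change π a * π b = π b * π a; rw [← map_mul, mul_comm, map_mul])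
  let _ : NormedCommRing B :=
    { SubringClass.toNormedRing B with
      mul_comm := (π.range.commRingTopologicalClosure hcomm).mul_comm }
  have hBc : IsClosed (B : Set (H →L[ℂ] H)) := π.range.isClosed_topologicalClosure
  have : CompleteSpace B := hBc.completeSpace_coe
  let ρ : A →ₐ[ℂ] B := π.toAlgHom.codRestrict B.toSubalgebra
    fun a => π.range.le_topologicalClosure ⟨a, rfl⟩
  by_contra! hcon
  refine hπg ((isPositive_iff_forall_spectrum (hg.map π)).2 fun z hz => ?_)
  rw [show π g = (ρ g : H →L[ℂ] H) from rfl, ← StarSubalgebra.spectrum_eq (hS := hBc),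
    WeakDual.CharacterSpace.mem_spectrum_iff_exists] at hz
  obtain ⟨ψ, rfl⟩ := hz
  refine hcon ((WeakDual.CharacterSpace.toAlgHom ψ).comp ρ) fun q hq => ?_
  refine (isPositive_iff_forall_spectrum ((hQ.isSelfAdjoint q hq).map π)).1 (hπQ q hq) _ ?_
  rw [show π q = (ρ q : H →L[ℂ] H) from rfl, ← StarSubalgebra.spectrum_eq (hS := hBc)]
  exact AlgHom.apply_mem_spectrum ψ (ρ q)

/-! ### Compatibility of `ς` and renaming with the involution -/

section Involutions

variable {σ τ : Type}

theorem star_wordSymbol (w : FreeMonoid σ) : star (wordSymbol w) = wordSymbol (star w) := by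
  change StatePoly.conj _ = _
  by_cases h : w = 1
  · subst h; simp [wordSymbol]
  · rw [wordSymbol, dif_neg h, wordSymbol, dif_neg (star_word_ne_one h)]
    simp [StatePoly.conj]

theorem sigmaNC_star (p : NCPoly σ) : sigmaNC (star p) = star (sigmaNC p) := by
  induction p using MonoidAlgebra.induction_linear with
  | zero => simp
  | add p q hp hq => rw [star_add, map_add, hp, hq, map_add, star_add]
  | single w a => rw [NCPoly.star_single, sigmaNC_single, sigmaNC_single, star_smul, star_wordSymbol]

theorem sigma_star (g : NCStatePoly σ) : sigma (star g) = star (sigma g) := by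
  induction g using TensorProduct.induction_on with
  | zero => simp
  | tmul s p => rw [TensorProduct.star_tmul, sigma_tmul, sigma_tmul, star_mul', sigmaNC_star]
  | add x y hx hy => rw [star_add, map_add, hx, hy, map_add, star_add]

theorem star_map (i : σ → τ) (w : FreeMonoid σ) :
    star (FreeMonoid.map i w) = FreeMonoid.map i (star w) :=
  (List.map_reverse (f := i) (l := w.toList)).symm

theorem rename_star (i : σ → τ) (g : NCStatePoly σ) : rename i (star g) = star (rename i g) := by
  induction g using TensorProduct.induction_on with
  | zero => simp
  | tmul s p =>
    rw [TensorProduct.star_tmul, rename, Algebra.TensorProduct.map_tmul,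
      Algebra.TensorProduct.map_tmul, TensorProduct.star_tmul]
    congr 1
    · change MvPolynomial.rename _ (StatePoly.conj s) = StatePoly.conj (MvPolynomial.rename _ s)
      induction s using MvPolynomial.induction_on with
      | C a => simp [StatePoly.conj]
      | add p q hp hq => simp only [map_add, hp, hq]
      | mul_X p w hp =>
        rw [map_mul, map_mul, hp, map_mul, map_mul]
        congr 1
        simp [StatePoly.conj, star_map]
    · induction p using MonoidAlgebra.induction_linear with
      | zero => simp
      | add p q hp hq => rw [star_add, map_add, hp, hq, map_add, star_add]
      | single w a =>
        rw [NCPoly.star_single]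
        simp [NCPoly.star_single, star_map]
  | add x y hx hy => rw [star_add, map_add, hx, hy, map_add, star_add]

theorem rename_var (i : σ → τ) (j : σ) : rename i (var j) = var (i j) := by
  simp [rename, var]

theorem isSelfAdjoint_var (j : σ) : IsSelfAdjoint (var j) := by
  rw [IsSelfAdjoint, var, TensorProduct.star_tmul, star_one, MonoidAlgebra.of_apply,
    NCPoly.star_single, star_one, FreeMonoid.star_of]

end Involutions

/-! ### The state quadratic module is an archimedean quadratic module -/

section StateQuadraticModules

variable {σ : Type}

theorem mem_QM_iff {C : Set (NCStatePoly σ)} {q : StatePoly σ} :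
    q ∈ QM C ↔ ∃ g ∈ weightedSquares C, sigma g = q := by
  constructor
  · rintro ⟨m, f, c, hc, rfl⟩
    exact ⟨_, ⟨m, f, c, hc, rfl⟩, map_sum _ _ _⟩
  · rintro ⟨_, ⟨m, f, c, hc, rfl⟩, rfl⟩
    exact ⟨m, f, c, hc, map_sum _ _ _⟩

theorem conj_mem_weightedSquares {C : Set (NCStatePoly σ)} {c : NCStatePoly σ} (hc : c ∈ C)
    (f : NCStatePoly σ) : star f * c * f ∈ weightedSquares C :=
  ⟨1, fun _ => f, fun _ => c, fun _ => .inr hc, by simp⟩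

theorem isQuadraticModule_weightedSquares {C : Set (NCStatePoly σ)}
    (hC : ∀ c ∈ C, IsSelfAdjoint c) : IsQuadraticModule (weightedSquares C) where
  isSelfAdjoint := by
    rintro _ ⟨m, f, c, hc, rfl⟩
    refine isSelfAdjoint_sum _ fun j _ => ?_
    refine IsSelfAdjoint.conjugate' ?_ (f j)
    rcases hc j with h | h
    · rw [h]; exact .one _
    · exact hC _ h
  one_mem := ⟨1, fun _ => 1, fun _ => 1, fun _ => .inl rfl, by simp⟩
  add_mem := by
    rintro _ ⟨m, f, c, hc, rfl⟩ _ ⟨m', f', c', hc', rfl⟩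
    refine ⟨m + m', Fin.append f f', Fin.append c c', fun j => ?_, ?_⟩
    · refine Fin.addCases (fun i => ?_) (fun i => ?_) j
      · rw [Fin.append_left]; exact hc i
      · rw [Fin.append_right]; exact hc' i
    · simp only [Fin.sum_univ_add, Fin.append_left, Fin.append_right]
  conj_mem := by
    rintro a _ ⟨m, f, c, hc, rfl⟩
    refine ⟨m, fun j => f j * a, c, hc, ?_⟩
    simp only [Finset.mul_sum, Finset.sum_mul, star_mul, mul_assoc]

theorem sigma_tmul_one_mul (s : StatePoly σ) (g : NCStatePoly σ) :
    sigma ((s ⊗ₜ 1) * g) = s * sigma g := by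
  rw [show (s ⊗ₜ 1) * g = s • g from (Algebra.smul_def s g).symm, map_smul, smul_eq_mul]

theorem commute_tmul_one (s : StatePoly σ) (g : NCStatePoly σ) :
    (s ⊗ₜ 1) * g = g * (s ⊗ₜ 1) :=
  Algebra.commutes (A := NCStatePoly σ) s g

theorem sigma_one : sigma (1 : NCStatePoly σ) = 1 := by
  rw [Algebra.TensorProduct.one_def, sigma_tmul, sigmaNC_one, one_mul]

theorem isQuadraticModule_QM {C : Set (NCStatePoly σ)}
    (hC : ∀ c ∈ C, IsSelfAdjoint c) : IsQuadraticModule (QM C) := by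
  have hW := isQuadraticModule_weightedSquares hC
  constructor
  · intro q hq
    obtain ⟨g, hg, rfl⟩ := mem_QM_iff.1 hq
    rw [IsSelfAdjoint, ← sigma_star, (hW.isSelfAdjoint g hg).star_eq]
  · exact mem_QM_iff.2 ⟨1, hW.one_mem, sigma_one⟩
  · intro p hp q hq
    obtain ⟨g, hg, rfl⟩ := mem_QM_iff.1 hp
    obtain ⟨h, hh, rfl⟩ := mem_QM_iff.1 hq
    exact mem_QM_iff.2 ⟨_, hW.add_mem _ hg _ hh, map_add _ _ _⟩
  · intro a q hq
    obtain ⟨g, hg, rfl⟩ := mem_QM_iff.1 hq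
    -- State polynomials are central and `sigma` is linear over them, so conjugation by `a` can be
    -- moved inside `sigma`.
    refine mem_QM_iff.2 ⟨_, hW.conj_mem (a ⊗ₜ 1) _ hg, ?_⟩
    rw [TensorProduct.star_tmul, star_one, mul_assoc, sigma_tmul_one_mul, ← commute_tmul_one,
      sigma_tmul_one_mul, mul_assoc, mul_comm a]

theorem IsArchimedean.isBoundedBy_var [Fintype σ] {C : Set (NCStatePoly σ)}
    (hC : ∀ c ∈ C, IsSelfAdjoint c) (h : IsArchimedean C) (j : σ) :
    IsBoundedBy (weightedSquares C) (var j) := by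
  classical
  have hW := isQuadraticModule_weightedSquares hC
  obtain ⟨N, hN, h⟩ := h
  have hsum : ∀ s : Finset σ, ∑ i ∈ s, var i ^ 2 ∈ weightedSquares C := by
    intro s
    induction s using Finset.induction_on with
    | empty => simpa using hW.zero_mem
    | insert i s hi hs =>
      rw [Finset.sum_insert hi]
      refine hW.add_mem _ ?_ _ hs
      have := hW.star_mul_self_mem (var i)
      rwa [(isSelfAdjoint_var i).star_eq, ← sq] at this
  refine ⟨N, hN.le, ?_⟩
  convert hW.add_mem _ h _ (hsum (Finset.univ.erase j)) using 1
  rw [← Finset.add_sum_erase _ _ (Finset.mem_univ j), (isSelfAdjoint_var j).star_eq, sq]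
  abel

theorem isBoundedBy_one_tmul {C : Set (NCStatePoly σ)} (hC : ∀ c ∈ C, IsSelfAdjoint c)
    (h : ∀ j, IsBoundedBy (weightedSquares C) (var j)) (p : NCPoly σ) :
    IsBoundedBy (weightedSquares C) (1 ⊗ₜ[ℂ] p) := by
  have hW := isQuadraticModule_weightedSquares hC
  induction p using MonoidAlgebra.induction_linear with
  | zero =>
    rw [TensorProduct.tmul_zero, ← map_zero (algebraMap ℂ (NCStatePoly σ))]
    exact hW.isBoundedBy_algebraMap 0
  | add p q hp hq => rw [TensorProduct.tmul_add]; exact hW.isBoundedBy_add hp hq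
  | single w a =>
    have hsingle : (1 : StatePoly σ) ⊗ₜ[ℂ] (MonoidAlgebra.single w a : NCPoly σ) =
        algebraMap ℂ (NCStatePoly σ) a * 1 ⊗ₜ MonoidAlgebra.of ℂ (FreeMonoid σ) w := by
      rw [show (MonoidAlgebra.single w a : NCPoly σ) = a • MonoidAlgebra.of ℂ (FreeMonoid σ) w by
        simp, TensorProduct.tmul_smul]
      exact Algebra.smul_def (A := NCStatePoly σ) a _
    rw [hsingle]
    clear hsingle
    refine hW.isBoundedBy_mul (hW.isBoundedBy_algebraMap a) ?_
    induction w using FreeMonoid.inductionOn' with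
    | one =>
      rw [map_one, ← Algebra.TensorProduct.one_def, ← map_one (algebraMap ℂ (NCStatePoly σ))]
      exact hW.isBoundedBy_algebraMap 1
    | of_mul x w hw =>
      rw [map_mul, ← one_mul (1 : StatePoly σ), ← Algebra.TensorProduct.tmul_mul_tmul]
      exact hW.isBoundedBy_mul (h x) hw

/-- Nonnegativity of the variance: `N - ς(g)*ς(g) = ς(N - g*g) + ς((g - ς(g))*(g - ς(g)))`. It
transfers boundedness from the variables to the generators `ς(w)`. -/
theorem isBoundedBy_sigma {C : Set (NCStatePoly σ)} (hC : ∀ c ∈ C, IsSelfAdjoint c)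
    {g : NCStatePoly σ} (h : IsBoundedBy (weightedSquares C) g) :
    IsBoundedBy (QM C) (sigma g) := by
  have hW := isQuadraticModule_weightedSquares hC
  obtain ⟨N, hN, h⟩ := h
  refine ⟨N, hN, mem_QM_iff.2
    ⟨_, hW.add_mem _ h _ (hW.star_mul_self_mem (g - sigma g ⊗ₜ 1)), ?_⟩⟩
  have h1 : algebraMap ℂ (NCStatePoly σ) N = (algebraMap ℂ (StatePoly σ) N) ⊗ₜ 1 := rfl
  have h2 : star (g - sigma g ⊗ₜ 1) * (g - sigma g ⊗ₜ 1) =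
      star g * g - star (sigma g) ⊗ₜ 1 * g - sigma g ⊗ₜ 1 * star g +
        star (sigma g) ⊗ₜ 1 * (sigma g ⊗ₜ 1 * 1) := by
    rw [star_sub, TensorProduct.star_tmul, star_one, mul_one, sub_mul, mul_sub, mul_sub,
      commute_tmul_one (sigma g) (star g)]
    abel
  rw [h2, h1]
  simp only [map_add, map_sub, sigma_tmul_one_mul, sigma_star, sigma_one, sigma_tmul, sigmaNC_one]
  ring

theorem isBoundedBy_QM {C : Set (NCStatePoly σ)} (hC : ∀ c ∈ C, IsSelfAdjoint c)
    (h : ∀ j, IsBoundedBy (weightedSquares C) (var j)) (s : StatePoly σ) :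
    IsBoundedBy (QM C) s := by
  have hQ := isQuadraticModule_QM hC
  induction s using MvPolynomial.induction_on with
  | C a => exact hQ.isBoundedBy_algebraMap a
  | add p q hp hq => exact hQ.isBoundedBy_add hp hq
  | mul_X p w hp =>
    refine hQ.isBoundedBy_mul hp ?_
    have := isBoundedBy_sigma hC (isBoundedBy_one_tmul hC h (MonoidAlgebra.single w.1 1))
    rwa [sigma_tmul, sigmaNC_single, one_smul, one_mul, wordSymbol, dif_neg w.2] at this

theorem StatePoly.exists_countable_span_eq_top [Countable σ] :
    ∃ S : Set (StatePoly σ), S.Countable ∧ Submodule.span ℂ S = ⊤ := by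
  have : Countable (FreeMonoid σ) := inferInstanceAs (Countable (List σ))
  exact ⟨_, Set.countable_range _, (MvPolynomial.basisMonomials _ ℂ).span_eq⟩

theorem evalState_nonneg_of_mem_QM {H : Type*} [NormedAddCommGroup H] [InnerProductSpace ℂ H]
    [CompleteSpace H] {C : Set (NCStatePoly σ)} {φ : OperatorState H} {X : σ → (H →L[ℂ] H)}
    (h : (φ, X) ∈ semialgebraicSet H C) {q : StatePoly σ} (hq : q ∈ QM C) :
    0 ≤ evalState φ X q := by
  obtain ⟨m, f, c, hc, rfl⟩ := hq
  rw [map_sum]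
  refine Finset.sum_nonneg fun j _ => ?_
  rw [evalState_sigma, map_mul (eval φ X), map_mul (eval φ X), eval_star h.1]
  refine map_nonneg φ.1 (star_left_conjugate_nonneg ?_ _)
  rw [ContinuousLinearMap.nonneg_iff_isPositive]
  rcases hc j with hj | hj
  · rw [hj, map_one]; exact ContinuousLinearMap.isPositive_one
  · exact h.2 _ hj

end StateQuadraticModules

theorem eval_var {σ : Type} {H : Type*} [NormedAddCommGroup H]
    [InnerProductSpace ℂ H] (φ : OperatorState H) (X : σ → (H →L[ℂ] H)) (j : σ) :
    eval φ X (var j) = X j := by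
  rw [var, eval_tmul, map_one, one_smul, evalNC_of]

/-! ### Test vectors and reflections -/

section Symmetry

variable {H : Type*} [NormedAddCommGroup H] [InnerProductSpace ℂ H]

theorem exists_inner_self_eq_one_of_not_isPositive {T : H →L[ℂ] H} (hT : ¬ T.IsPositive) :
    ∃ w : H, ⟪w, w⟫_ℂ = 1 ∧ ¬ 0 ≤ ⟪w, T w⟫_ℂ := by
  obtain ⟨x, hx⟩ := not_forall.1 (mt (isPositive_iff_forall_inner_nonneg T).2 hT)
  have hx0 : ‖x‖ ≠ 0 := by
    rw [norm_ne_zero_iff]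
    rintro rfl
    simp at hx
  have hscale : ∀ y z : H, ⟪(‖x‖⁻¹ : ℂ) • y, (‖x‖⁻¹ : ℂ) • z⟫_ℂ =
      ((‖x‖⁻¹ * ‖x‖⁻¹ : ℝ) : ℂ) * ⟪y, z⟫_ℂ := fun y z => by
    rw [inner_smul_left, inner_smul_right, ← Complex.ofReal_inv, Complex.conj_ofReal, ← mul_assoc,
      Complex.ofReal_mul]
  refine ⟨(‖x‖⁻¹ : ℂ) • x, ?_, fun h => hx ?_⟩
  · have hx1 : (‖x‖ : ℂ) ≠ 0 := Complex.ofReal_ne_zero.2 hx0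
    rw [hscale, inner_self_eq_norm_sq_to_K, Complex.ofReal_mul, Complex.ofReal_inv]
    change (‖x‖ : ℂ)⁻¹ * (‖x‖ : ℂ)⁻¹ * (‖x‖ : ℂ) ^ 2 = 1
    field_simp
  · rw [map_smul, hscale] at h
    have h2 := mul_nonneg (Complex.zero_le_real.2 (mul_self_nonneg ‖x‖)) h
    rwa [← mul_assoc, ← Complex.ofReal_mul, mul_mul_mul_comm, mul_inv_cancel₀ hx0, one_mul,
      Complex.ofReal_one, one_mul] at h2

variable [CompleteSpace H]

/-- Orthogonal unit vectors are swapped by a symmetry. -/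
theorem exists_symmetry_apply_eq {v w : H} (hv : ⟪v, v⟫_ℂ = 1) (hw : ⟪w, w⟫_ℂ = 1)
    (hvw : ⟪v, w⟫_ℂ = 0) :
    ∃ U : H →L[ℂ] H, IsSelfAdjoint U ∧ U ^ 2 = 1 ∧ U v = w := by
  have hwv : ⟪w, v⟫_ℂ = 0 := by rw [← inner_conj_symm, hvw, map_zero]
  -- The reflection in the hyperplane orthogonal to `v - w`; since `‖v - w‖² = 2`, the factor `2 /
  -- ‖v - w‖²` equals `1`.
  refine ⟨1 - InnerProductSpace.rankOne ℂ (v - w) (v - w), ?_, ?_, ?_⟩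
  · exact .sub (.one _) (InnerProductSpace.isPositive_rankOne_self _).isSelfAdjoint
  · ext x
    have hd : ⟪v - w, v - w⟫_ℂ = 2 := by
      rw [inner_sub_left, inner_sub_right, inner_sub_right, hv, hw, hvw, hwv]
      norm_num
    rw [sq, mul_apply_eq_comp]
    simp only [sub_apply, one_apply_eq_self, InnerProductSpace.rankOne_apply, inner_sub_right,
      inner_smul_right]
    rw [← inner_sub_right (v - w) v w, hd]
    module
  · rw [sub_apply, one_apply_eq_self, InnerProductSpace.rankOne_apply, inner_sub_left, hv, hwv,
      sub_zero, one_smul, sub_sub_cancel]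

end Symmetry

/-! ### Adjoining the symmetry `x_0`: the two implications -/

section Extension

variable {n : ℕ}

/-- The constraints `C` together with `x_0 ^ 2 = 1` for an additional variable `x_0`. -/
abbrev adjoinSymmetry (C : Set (NCStatePoly (Fin n))) : Set (NCStatePoly (Fin (n + 1))) :=
  rename Fin.succ '' C ∪ {1 - var (0 : Fin (n + 1)) ^ 2, -(1 - var 0 ^ 2)}

theorem isSelfAdjoint_of_mem_adjoinSymmetry {C : Set (NCStatePoly (Fin n))}
    (hC : ∀ c ∈ C, IsSelfAdjoint c) :
    ∀ c ∈ adjoinSymmetry C,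
      IsSelfAdjoint c := by
  have hvar : IsSelfAdjoint (1 - var (0 : Fin (n + 1)) ^ 2) :=
    .sub (.one _) ((isSelfAdjoint_var 0).pow 2)
  rintro c (⟨c, hc, rfl⟩ | rfl | rfl)
  · rw [IsSelfAdjoint, ← rename_star, (hC c hc).star_eq]
  · exact hvar
  · exact hvar.neg

theorem isArchimedean_adjoinSymmetry {C : Set (NCStatePoly (Fin n))} (hCsa : ∀ c ∈ C, IsSelfAdjoint c)
    (h : IsArchimedean C) :
    IsArchimedean (adjoinSymmetry C) := by
  have hW := isQuadraticModule_weightedSquares (isSelfAdjoint_of_mem_adjoinSymmetry hCsa)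
  obtain ⟨N, hN, m, f, c, hc, h⟩ := h
  -- The extra `1` is used for `x_0²`, through the constraint `1 - x_0²`.
  refine ⟨N + 1, by positivity, ?_⟩
  have h1 : rename Fin.succ (algebraMap ℂ (NCStatePoly (Fin n)) N - ∑ j, var j ^ 2) ∈
      weightedSquares (adjoinSymmetry C) := by
    refine ⟨m, fun j => rename Fin.succ (f j), fun j => rename Fin.succ (c j), fun j => ?_, ?_⟩
    · rcases hc j with hj | hj
      · exact .inl (by simp only [hj, map_one])
      · exact .inr (.inl ⟨_, hj, rfl⟩)
    · simp only [h, map_sum, map_mul, rename_star]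
  have h2 := conj_mem_weightedSquares (C := adjoinSymmetry C) (.inr (.inl rfl)) 1
  convert hW.add_mem _ h1 _ h2 using 1
  rw [Fin.sum_univ_succ, map_sub, AlgHom.commutes, map_sum]
  simp only [map_pow, rename_var, star_one, one_mul, mul_one, Complex.ofReal_add,
    Complex.ofReal_one]
  rw [map_add, map_one]
  abel

variable {H : Type*} [NormedAddCommGroup H] [InnerProductSpace ℂ H] [CompleteSpace H]
  [TopologicalSpace.SeparableSpace H]

theorem add_mem_QM_adjoinSymmetry (hH : ¬ FiniteDimensional ℂ H) {C : Set (NCStatePoly (Fin n))}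
    (hCsa : ∀ c ∈ C, IsSelfAdjoint c) (hC : IsArchimedean C) {f : NCStatePoly (Fin n)}
    (hf : IsSelfAdjoint f) (hpos : ∀ P ∈ semialgebraicSet H C, (eval P.1 P.2 f).IsPositive)
    {ε : ℝ} (hε : 0 < ε) :
    sigma (var (0 : Fin (n + 1)) * rename Fin.succ f * var 0) +
        algebraMap ℂ (StatePoly (Fin (n + 1))) (ε : ℂ) ∈ QM (adjoinSymmetry C) := by
  have hC'sa := isSelfAdjoint_of_mem_adjoinSymmetry hCsa
  have hbvar := (isArchimedean_adjoinSymmetry hCsa hC).isBoundedBy_var hC'sa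
  have hW := isQuadraticModule_weightedSquares hC'sa
  have hQ := isQuadraticModule_QM hC'sa
  by_contra hnot
  have hg : IsSelfAdjoint (sigma (var (0 : Fin (n + 1)) * rename Fin.succ f * var 0)) := by
    rw [IsSelfAdjoint, ← sigma_star, star_mul, star_mul, ← rename_star, hf.star_eq,
      (isSelfAdjoint_var (0 : Fin (n + 1))).star_eq, mul_assoc]
  obtain ⟨χ, hχ, hχg⟩ := hQ.exists_character hH StatePoly.exists_countable_span_eq_top
    (isBoundedBy_QM hC'sa hbvar) hg hε hnot
  have hχσ : ∀ g ∈ weightedSquares (adjoinSymmetry C), 0 ≤ χ (sigmaNC (specialize χ g)) := by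
    intro g hg
    rw [← map_sigma]
    exact hχ _ (mem_QM_iff.2 ⟨g, hg, rfl⟩)
  have hstar : ∀ p : NCPoly (Fin (n + 1)), specialize χ (star (1 ⊗ₜ p)) = star p := by
    intro p
    rw [TensorProduct.star_tmul, star_one, specialize_tmul, map_one, one_smul]
  have hone : ∀ p : NCPoly (Fin (n + 1)), specialize χ (1 ⊗ₜ p) = p := by
    intro p
    rw [specialize_tmul, map_one, one_smul]
  -- All summands carry the same functional `χ ∘ ς`; repetition serves only to fill the
  -- infinite-dimensional `H`.
  obtain ⟨φ, X, v, hφ, hX, -, hev, -, hpX⟩ := exists_realization hH χ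
    (fun _ => χ.toLinearMap ∘ₗ sigmaNC)
    (fun _ p => by
      have h := hχσ _ (hW.star_mul_self_mem (1 ⊗ₜ p))
      rwa [map_mul, hstar, hone] at h)
    (fun _ => by
      change χ (sigmaNC 1) = 1
      rw [sigmaNC_one, map_one])
    (fun p => by
      obtain ⟨N, -, hN⟩ := isBoundedBy_one_tmul hC'sa hbvar p
      refine ⟨N, fun _ q => ?_⟩
      have h := hχσ _ (hW.conj_mem (1 ⊗ₜ q) _ hN)
      rw [map_mul (specialize χ), map_mul (specialize χ), map_sub (specialize χ),
        map_mul (specialize χ), hstar, hstar, hone, hone, AlgHom.commutes, mul_sub,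
        sub_mul, ← Algebra.commutes, mul_assoc (algebraMap ℂ _ _), ← Algebra.smul_def, map_sub,
        map_sub, sub_nonneg, map_smul, map_smul, smul_eq_mul] at h
      exact h)
    (fun _ => rfl)
  have hmem : (φ, X ∘ Fin.succ) ∈ semialgebraicSet H C := by
    refine ⟨fun j => hX _, fun c hc => ?_⟩
    rw [← eval_rename]
    refine hpX _ fun _ p => ?_
    have h := hχσ _ (conj_mem_weightedSquares (.inl ⟨c, hc, rfl⟩) (1 ⊗ₜ p))
    rwa [map_mul (specialize χ), map_mul (specialize χ), hstar, hone] at h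
  have hfpos := hpos _ hmem
  rw [← eval_rename] at hfpos
  refine hχg ?_
  -- The value of `χ` at `ς(x_0 f x_0)` is `φ(X_0 f(φ, X) X_0)`, the state of a conjugate of a
  -- positive operator.
  rw [← hev, evalState_sigma, map_mul (eval φ X), map_mul (eval φ X)]
  refine map_nonneg φ.1 ?_
  have hX0 : IsSelfAdjoint (eval φ X (var 0)) := by
    rw [IsSelfAdjoint, ← eval_star hX, (isSelfAdjoint_var (0 : Fin (n + 1))).star_eq]
  have h := star_left_conjugate_nonneg
    ((ContinuousLinearMap.nonneg_iff_isPositive _).2 hfpos) (eval φ X (var 0))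
  rwa [hX0.star_eq] at h

theorem isPositive_of_add_mem_QM_adjoinSymmetry (hH : ¬ FiniteDimensional ℂ H)
    {C : Set (NCStatePoly (Fin n))} {f : NCStatePoly (Fin n)}
    (h : ∀ ε : ℝ, 0 < ε → sigma (var (0 : Fin (n + 1)) * rename Fin.succ f * var 0) +
      algebraMap ℂ (StatePoly (Fin (n + 1))) (ε : ℂ) ∈ QM (adjoinSymmetry C))
    {φ : OperatorState H} {X : Fin n → (H →L[ℂ] H)} (hmem : (φ, X) ∈ semialgebraicSet H C) :
    (eval φ X f).IsPositive := by
  obtain ⟨hX, hc⟩ := hmem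
  by_contra hneg
  obtain ⟨w, hw1, hw⟩ := exists_inner_self_eq_one_of_not_isPositive hneg
  -- Index `0` keeps the state values of `φ`; index `1` records the failure of positivity at `w`;
  -- the remaining indices repeat it.
  let ψ : ℕ → OperatorState H := fun k => if k = 0 then φ else vectorState w hw1
  obtain ⟨φ', X', v, hφ', hX', hv, hev, hvf, hpX⟩ := exists_realization hH (evalState φ X)
    (fun k => (ψ k).1.toLinearMap ∘ₗ (evalNC X).toLinearMap)
    (fun k p => by
      change 0 ≤ (ψ k).1 (evalNC X (star p * p))
      rw [map_mul (evalNC X), evalNC_star hX]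
      exact map_nonneg (ψ k).1 (star_mul_self_nonneg _))
    (fun k => by
      change (ψ k).1 (evalNC X 1) = 1
      rw [map_one, (ψ k).2])
    (fun p => by
      -- The bound comes from `p(X)*p(X) ≤ ‖p(X)‖²`, uniformly over all the states.
      refine ⟨‖evalNC X p‖ ^ 2, fun k q => ?_⟩
      change (ψ k).1 (evalNC X _) ≤ _ * (ψ k).1 (evalNC X _)
      rw [map_mul (evalNC X), map_mul (evalNC X), map_mul (evalNC X), map_mul (evalNC X),
        evalNC_star hX, evalNC_star hX]
      have h1 := star_left_conjugate_le_conjugate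
        (CStarAlgebra.star_mul_le_algebraMap_norm_sq (a := evalNC X p)) (evalNC X q)
      rw [← Algebra.commutes, mul_assoc (algebraMap ℝ _ _), ← Algebra.smul_def,
        ← Complex.coe_smul] at h1
      have h2 := OrderHomClass.mono (ψ k).1 h1
      rwa [map_smul, smul_eq_mul] at h2)
    (fun p => (evalState_sigmaNC φ X p).symm)
  obtain ⟨U, hU, hU2, hUv⟩ := exists_symmetry_apply_eq (v := v 0) (w := v 1)
    (by rw [hv, if_pos rfl]) (by rw [hv, if_pos rfl])
    (by rw [hv, if_neg zero_ne_one])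
  have hsucc : (Fin.cons U X' : Fin (n + 1) → (H →L[ℂ] H)) ∘ Fin.succ = X' := rfl
  have hvar : eval φ' (Fin.cons U X' : Fin (n + 1) → (H →L[ℂ] H)) (var 0) = U := by
    rw [eval_var, Fin.cons_zero]
  have hmem' : (φ', (Fin.cons U X' : Fin (n + 1) → (H →L[ℂ] H))) ∈
      semialgebraicSet H (adjoinSymmetry C) := by
    refine ⟨fun j => ?_, ?_⟩
    · refine Fin.cases ?_ (fun i => ?_) j
      · exact hU
      · exact hX' i
    · rintro c (⟨c, hcC, rfl⟩ | rfl | rfl)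
      · rw [eval_rename]
        refine hpX c fun k p => ?_
        change 0 ≤ (ψ k).1 (evalNC X _)
        rw [map_mul (evalNC X), map_mul (evalNC X), evalNC_star hX, ← eval_eq_evalNC_specialize]
        exact map_nonneg (ψ k).1 (star_left_conjugate_nonneg
          ((ContinuousLinearMap.nonneg_iff_isPositive _).2 (hc c hcC)) _)
      · simp only [map_sub, map_one, map_pow, hvar, hU2, sub_self]
        exact ContinuousLinearMap.isPositive_zero
      · simp only [map_neg, map_sub, map_one, map_pow, hvar, hU2, sub_self, neg_zero]
        exact ContinuousLinearMap.isPositive_zero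
  -- Since `U` is self-adjoint and maps `v 0` to `v 1`, the state of `U f U` is `⟪v 1, f(φ', X') (v
  -- 1)⟫`, which is `⟪w, f(φ, X) w⟫` by the choice of the functional at index `1`.
  have hval : ∀ ε : ℝ, 0 < ε → 0 ≤ ⟪w, eval φ X f w⟫_ℂ + ε := by
    intro ε hε
    have h1 := evalState_nonneg_of_mem_QM hmem' (h ε hε)
    rw [map_add, AlgHom.commutes, evalState_sigma, map_mul (eval φ' _), map_mul (eval φ' _), hvar,
      eval_rename, hsucc, hφ', mul_apply_eq_comp, mul_apply_eq_comp, hUv, ← hU.adjoint_eq,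
      ContinuousLinearMap.adjoint_inner_right, hUv, hvf] at h1
    rw [eval_eq_evalNC_specialize]
    exact h1
  -- The real part needs every `ε`; a single one, `ε = 1`, shows that the imaginary part vanishes.
  refine hw (Complex.le_def.2 ⟨le_of_forall_pos_le_add fun ε hε => ?_, ?_⟩)
  · simpa using (Complex.le_def.1 (hval ε hε)).1
  · simpa using (Complex.le_def.1 (hval 1 one_pos)).2

end Extension

end StatePolynomials

end

open StatePolynomials in
theorem corollary1 {H : Type*} [NormedAddCommGroup H] [InnerProductSpace ℂ H] [CompleteSpace H]
    [TopologicalSpace.SeparableSpace H] (hH : ¬ FiniteDimensional ℂ H)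
    (n : ℕ) (C : Set (NCStatePoly (Fin n))) (hCsa : ∀ c ∈ C, IsSelfAdjoint c)
    (hC : IsArchimedean C) (f : NCStatePoly (Fin n)) (hf : IsSelfAdjoint f) :
    (∀ P ∈ semialgebraicSet H C, (eval P.1 P.2 f).IsPositive) ↔
      ∀ ε : ℝ, 0 < ε →
        sigma (var (0 : Fin (n + 1)) * rename Fin.succ f * var 0) +
            algebraMap ℂ (StatePoly (Fin (n + 1))) (ε : ℂ) ∈
          QM (rename Fin.succ '' C ∪ {1 - var 0 ^ 2, -(1 - var 0 ^ 2)}) := by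
  exact ⟨fun hpos ε hε => add_mem_QM_adjoinSymmetry hH hCsa hC hf hpos hε,
    fun h _ hP => isPositive_of_add_mem_QM_adjoinSymmetry hH h hP⟩
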